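/- **Setting.** Let $(X,d,\mu)$ be a metric measure space: $(X,d)$ is a metric space and $\mu$ is a Borel measure with $0<\mu(B(x,r))<\infty$ for every open ball $B(x,r)$, $r>0$. *Exponents.* $\mathcal P(X)$ is the set of measurable $q:X\to(0,\infty]$ with $q^-:=\operatorname{ess\,inf}_X q>0$; $\mathcal P_b(X)$ is the set of (essentially) bounded real-valued members of $\mathcal P(X)$; and $\mathcal P_b^{\log}(X)$ is the set of $p\in\mathcal P_b(X)$ for which there is $C>0$ with $$\left|\tfrac1{p(x)}-\tfrac1{p(y)}\right|\le \frac{C}{\log(e+1/d(x,y))}\qquad\text{for all distinct }x,y\in X.$$ For $p,q\in\mathcal P_b(X)$, $p\ll q$ (equivalently $q\gg p$) means $\operatorname{ess\,inf}_X(q-p)>0$. *Function spaces.* For $p\in\mathcal P_b(X)$ and measurable $f$ with values in $[-\infty,\infty]$, let $\rho_{p(\cdot)}(f)=\int_X|f|^{p(x)}\,d\mu$ and $\|f\|_{L^{p(\cdot)}}=\inf\{\lambda>0:\rho_{p(\cdot)}(f/\lambda)\le1\}$ (always $\inf\emptyset=\infty$). $L^{p(\cdot)}(X)$ is the space of measurable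 $u:X\to\mathbb R$ with $\rho_{p(\cdot)}(u)<\infty$. For a sequence $g=(g_k)_{k\in\mathbb Z}$ of measurable functions $g_k:X\to[0,\infty]$ and $q\in\mathcal P(X)$, let $$\|g\|_{L^{p(\cdot)}(\ell^{q(\cdot)})}=\Big\|\,x\mapsto\|(g_k(x))_{k}\|_{\ell^{q(x)}}\Big\|_{L^{p(\cdot)}},\qquad \|g\|_{\ell^{q(\cdot)}(L^{p(\cdot)})}=\inf\{\lambda>0:\rho(g/\lambda)\le1\},$$ where $\rho(g)=\sum_{k\in\mathbb Z}\inf\{\lambda>0:\rho_{p(\cdot)}(g_k\lambda^{-1/q(\cdot)})\le1\}$ and $\lambda^{1/\infty}:=1$. For $s\in\mathcal P_b(X)$ and measurable $u:X\to\mathbb R$, let $\mathbb D^{s(\cdot)}(u)$ be the set of such $g$ for which there is a $\mu$-null set $N$ with $$|u(x)-u(y)|\le d(x,y)^{s(x)}g_k(x)+d(x,y)^{s(y)}g_k(y)$$ for all $k\in\mathbb Z$ and $x,y\in X\setminus N$ with $2^{-k-1}\le d(x,y)<2^{-k}$. The Hajłasz–Triebel–Lizorkin space $M^{s(\cdot)}_{p(\cdot),q(\cdot)}(X)$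 and the Hajłasz–Besov space $N^{s(\cdot)}_{p(\cdot),q(\cdot)}(X)$ consist of the $u\in L^{p(\cdot)}(X)$ for which, respectively, $$\|u\|_{M}:=\|u\|_{L^{p(\cdot)}}+\inf_{g\in\mathbb D^{s(\cdot)}(u)}\|g\|_{L^{p(\cdot)}(\ell^{q(\cdot)})}<\infty,\qquad \|u\|_{N}:=\|u\|_{L^{p(\cdot)}}+\inf_{g\in\mathbb D^{s(\cdot)}(u)}\|g\|_{\ell^{q(\cdot)}(L^{p(\cdot)})}<\infty.$$ A continuous embedding $E\hookrightarrow L^{r(\cdot)}(X)$ means that $E\subseteq L^{r(\cdot)}(X)$ and there is $C<\infty$ with $\|u\|_{L^{r(\cdot)}}\le C\|u\|_E$ for all $u\in E$. **Theorem.** Suppose that $(X,d)$ is geometrically doubling (there is $M$ such that every ball $B(x,r)$ can be covered by at most $M$ balls of radius $r/2$), that $\sup_{x\in X}\mu(B(x,\delta))<\infty$ for some $\delta\in(0,\infty)$, and that $\mu$ is lower Ahlfors $Q(\cdot)$-regular for some $Q\in\mathcal P^{\log}_b(X)$ (there is $b>0$ with $\mu(B(x,r))\ge b\,r^{Q(x)}$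 for all $x\in X$ and $r\in(0,1]$). Let $p,s\in\mathcal P^{\log}_b(X)$ satisfy $sp=Q$ on $X$. Then: 1. for every $q\in\mathcal P(X)$ and every $\beta\in\mathcal P_b(X)$ with $\beta\gg p$, $M^{s(\cdot)}_{p(\cdot),q(\cdot)}(X)\hookrightarrow L^{\beta(\cdot)}(X)$; 2. for every $q\in\mathcal P(X)$ with $q\le p$ and every $\beta\in\mathcal P_b(X)$ with $\beta\gg p$, $N^{s(\cdot)}_{p(\cdot),q(\cdot)}(X)\hookrightarrow L^{\beta(\cdot)}(X)$; 3. for every $q\in\mathcal P(X)$ and every $t\in\mathcal P^{\log}_b(X)$ with $t\ll s$, $N^{s(\cdot)}_{p(\cdot),q(\cdot)}(X)\hookrightarrow L^{\sigma(\cdot)}(X)$, where $\sigma:=\dfrac{Qp}{Q-tp}$. -/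

import Mathlib

open MeasureTheory
open scoped ENNReal NNReal

namespace VarHajlasz

/-! ### Metric measure spaces -/

/-- Every ball of positive radius has positive and finite measure. -/
def IsMetricMeasure {X : Type*} [MetricSpace X] [MeasurableSpace X] (μ : Measure X) : Prop :=
  ∀ (x : X) (r : ℝ), 0 < r → 0 < μ (Metric.ball x r) ∧ μ (Metric.ball x r) < ∞

/-- Every ball can be covered by at most `M` balls of half the radius. -/
def GeometricallyDoubling (X : Type*) [MetricSpace X] : Prop :=
  ∃ M : ℕ, ∀ (x : X) (r : ℝ), 0 < r →
    ∃ F : Finset X, F.card ≤ M ∧ Metric.ball x r ⊆ ⋃ y ∈ F, Metric.ball y (r / 2)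

/-- Lower Ahlfors `Q(·)`-regularity: `μ (B(x,r)) ≥ b r^{Q(x)}` for all `x` and `0 < r ≤ 1`. -/
def LowerAhlforsRegular {X : Type*} [MetricSpace X] [MeasurableSpace X] (μ : Measure X)
    (Q : X → ℝ) : Prop :=
  ∃ b : ℝ, 0 < b ∧ ∀ (x : X) (r : ℝ), 0 < r → r ≤ 1 →
    ENNReal.ofReal (b * r ^ Q x) ≤ μ (Metric.ball x r)

/-! ### Variable exponents -/

/-- The class `𝒫(X)`: measurable `q : X → (0, ∞]` with positive essential infimum. -/
structure IsExponent {X : Type*} [MeasurableSpace X] (μ : Measure X) (q : X → ℝ≥0∞) : Prop where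
  measurable : Measurable q
  pos : ∀ x, 0 < q x
  essInf_pos : 0 < essInf q μ

/-- The class `𝒫_b(X)`: (essentially) bounded exponents, written as real-valued functions. -/
structure IsBddExponent {X : Type*} [MeasurableSpace X] (μ : Measure X) (p : X → ℝ) : Prop where
  measurable : Measurable p
  pos : ∀ x, 0 < p x
  bdd_below : ∃ c : ℝ, 0 < c ∧ ∀ᵐ x ∂μ, c ≤ p x
  bdd_above : ∃ C : ℝ, ∀ᵐ x ∂μ, p x ≤ C

/-- Local log-Hölder continuity on the whole space. For `x = y` the inequality reads `0 ≤ C`. -/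
def LogHolder {X : Type*} [MetricSpace X] (f : X → ℝ) : Prop :=
  ∃ C : ℝ, 0 < C ∧ ∀ x y : X, |f x - f y| ≤ C / Real.log (Real.exp 1 + 1 / dist x y)

/-- The class `𝒫_b^log(X)`: bounded exponents whose reciprocal is log-Hölder continuous. -/
structure IsLogExponent {X : Type*} [MetricSpace X] [MeasurableSpace X] (μ : Measure X)
    (p : X → ℝ) : Prop extends IsBddExponent μ p where
  logHolder : LogHolder fun x => 1 / p x

/-- `p ≪ q`, that is, the essential infimum of `q - p` is positive. -/
def StronglyLess {X : Type*} [MeasurableSpace X] (μ : Measure X) (p q : X → ℝ) : Prop :=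
  ∃ c : ℝ, 0 < c ∧ ∀ᵐ x ∂μ, c ≤ q x - p x

/-! ### Variable exponent Lebesgue spaces -/

/-- The semi-modular `ρ_{p(·)}(f) = ∫ f(x)^{p(x)} dμ(x)` of a `[0, ∞]`-valued function. -/
noncomputable def modular {X : Type*} [MeasurableSpace X] (μ : Measure X) (p : X → ℝ)
    (f : X → ℝ≥0∞) : ℝ≥0∞ :=
  ∫⁻ x, f x ^ p x ∂μ

/-- The Luxemburg quasi-norm `inf {l > 0 : ρ_{p(·)}(f / l) ≤ 1}`, with `inf ∅ = ∞`. -/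
noncomputable def luxNorm {X : Type*} [MeasurableSpace X] (μ : Measure X) (p : X → ℝ)
    (f : X → ℝ≥0∞) : ℝ≥0∞ :=
  ⨅ (l : ℝ≥0) (_ : 0 < l ∧ modular μ p (fun x => f x / l) ≤ 1), (l : ℝ≥0∞)

/-- The space `L^{p(·)}(X, μ)` of measurable real-valued functions with finite semi-modular. -/
def lpSpace {X : Type*} [MeasurableSpace X] (μ : Measure X) (p : X → ℝ) : Set (X → ℝ) :=
  {u | Measurable u ∧ modular μ p (fun x => ‖u x‖ₑ) < ∞}

/-! ### Mixed Lebesgue sequence spaces -/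

open Classical in
/-- The `ℓ^q` quasi-norm of a `[0, ∞]`-valued two-sided sequence, `0 < q ≤ ∞`. -/
noncomputable def seqNorm (q : ℝ≥0∞) (a : ℤ → ℝ≥0∞) : ℝ≥0∞ :=
  if q = ∞ then ⨆ k, a k else (∑' k, a k ^ q.toReal) ^ (1 / q.toReal)

/-- The quasi-norm of `L^{p(·)}(ℓ^{q(·)})`. -/
noncomputable def lpSeqNorm {X : Type*} [MeasurableSpace X] (μ : Measure X) (p : X → ℝ)
    (q : X → ℝ≥0∞) (g : ℤ → X → ℝ≥0∞) : ℝ≥0∞ :=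
  luxNorm μ p fun x => seqNorm (q x) fun k => g k x

/-- The semi-modular of `ℓ^{q(·)}(L^{p(·)})`, namely
`∑_k inf {l > 0 : ρ_{p(·)}(g_k / l^{1/q(·)}) ≤ 1}`, with the convention `l^{1/∞} = 1`. -/
noncomputable def seqLpModular {X : Type*} [MeasurableSpace X] (μ : Measure X) (p : X → ℝ)
    (q : X → ℝ≥0∞) (g : ℤ → X → ℝ≥0∞) : ℝ≥0∞ :=
  ∑' k, ⨅ (l : ℝ≥0) (_ : 0 < l ∧
    modular μ p (fun x => g k x / (l : ℝ≥0∞) ^ ((q x)⁻¹).toReal) ≤ 1), (l : ℝ≥0∞)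

/-- The quasi-norm of `ℓ^{q(·)}(L^{p(·)})`. -/
noncomputable def seqLpNorm {X : Type*} [MeasurableSpace X] (μ : Measure X) (p : X → ℝ)
    (q : X → ℝ≥0∞) (g : ℤ → X → ℝ≥0∞) : ℝ≥0∞ :=
  ⨅ (l : ℝ≥0) (_ : 0 < l ∧ seqLpModular μ p q (fun k x => g k x / l) ≤ 1), (l : ℝ≥0∞)

/-! ### Hajłasz–Triebel–Lizorkin and Hajłasz–Besov spaces -/

/-- The vector `s(·)`-gradients of `u`: sequences `(g_k)` of measurable functions
`g_k : X → [0, ∞]` such that, off a null set,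
`|u(x) - u(y)| ≤ d(x,y)^{s(x)} g_k(x) + d(x,y)^{s(y)} g_k(y)`
whenever `2^{-k-1} ≤ d(x,y) < 2^{-k}`. -/
def vectorGradients {X : Type*} [MetricSpace X] [MeasurableSpace X] (μ : Measure X) (s : X → ℝ)
    (u : X → ℝ) : Set (ℤ → X → ℝ≥0∞) :=
  {g | (∀ k, Measurable (g k)) ∧ ∃ N : Set X, μ N = 0 ∧
    ∀ (k : ℤ) (x y : X), x ∉ N → y ∉ N →
      (2 : ℝ) ^ (-k - 1) ≤ dist x y → dist x y < (2 : ℝ) ^ (-k) →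
      ENNReal.ofReal |u x - u y| ≤
        ENNReal.ofReal (dist x y ^ s x) * g k x + ENNReal.ofReal (dist x y ^ s y) * g k y}

/-- The homogeneous Hajłasz–Triebel–Lizorkin quasi-seminorm. -/
noncomputable def tlSeminorm {X : Type*} [MetricSpace X] [MeasurableSpace X] (μ : Measure X)
    (s p : X → ℝ) (q : X → ℝ≥0∞) (u : X → ℝ) : ℝ≥0∞ :=
  ⨅ g ∈ vectorGradients μ s u, lpSeqNorm μ p q g

/-- The homogeneous Hajłasz–Besov quasi-seminorm. -/
noncomputable def besovSeminorm {X : Type*} [MetricSpace X] [MeasurableSpace X] (μ : Measure X)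
    (s p : X → ℝ) (q : X → ℝ≥0∞) (u : X → ℝ) : ℝ≥0∞ :=
  ⨅ g ∈ vectorGradients μ s u, seqLpNorm μ p q g

/-- The inhomogeneous Hajłasz–Triebel–Lizorkin space `M^{s(·)}_{p(·),q(·)}(X)`. -/
def tlSpace {X : Type*} [MetricSpace X] [MeasurableSpace X] (μ : Measure X)
    (s p : X → ℝ) (q : X → ℝ≥0∞) : Set (X → ℝ) :=
  {u | u ∈ lpSpace μ p ∧ tlSeminorm μ s p q u < ∞}

/-- The quasi-norm of `M^{s(·)}_{p(·),q(·)}(X)`. -/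
noncomputable def tlNorm {X : Type*} [MetricSpace X] [MeasurableSpace X] (μ : Measure X)
    (s p : X → ℝ) (q : X → ℝ≥0∞) (u : X → ℝ) : ℝ≥0∞ :=
  luxNorm μ p (fun x => ‖u x‖ₑ) + tlSeminorm μ s p q u

/-- The inhomogeneous Hajłasz–Besov space `N^{s(·)}_{p(·),q(·)}(X)`. -/
def besovSpace {X : Type*} [MetricSpace X] [MeasurableSpace X] (μ : Measure X)
    (s p : X → ℝ) (q : X → ℝ≥0∞) : Set (X → ℝ) :=
  {u | u ∈ lpSpace μ p ∧ besovSeminorm μ s p q u < ∞}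

/-- The quasi-norm of `N^{s(·)}_{p(·),q(·)}(X)`. -/
noncomputable def besovNorm {X : Type*} [MetricSpace X] [MeasurableSpace X] (μ : Measure X)
    (s p : X → ℝ) (q : X → ℝ≥0∞) (u : X → ℝ) : ℝ≥0∞ :=
  luxNorm μ p (fun x => ‖u x‖ₑ) + besovSeminorm μ s p q u

/-- The continuous embedding of a function space `E` with quasi-norm `normE` into `L^{r(·)}`. -/
def EmbedsInLp {X : Type*} [MeasurableSpace X] (μ : Measure X) (E : Set (X → ℝ))
    (normE : (X → ℝ) → ℝ≥0∞) (r : X → ℝ) : Prop :=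
  ∃ C : ℝ≥0, ∀ u ∈ E, u ∈ lpSpace μ r ∧ luxNorm μ r (fun x => ‖u x‖ₑ) ≤ C * normE u

end VarHajlasz

namespace VarHajlasz

/-! ### Exponents -/

/-! All three embeddings come from one fact: if `u` has modular at most 1 and every component `g k`
of a vector gradient has modular at most 1, then the modular of `u` for any essentially bounded
exponent `β ≥ p` is bounded by a constant independent of `u` (`exists_modular_le`). The summability
in `q` plays no further role.

Give up a small `ε` of smoothness and put `w = max |u| (⨆ k ≥ 0, 2^(-εk) g_k)`. A geometric series
keeps the modular of `w` bounded, and `w` is a pointwise gradient of order `s - ε` at distances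
below 1. Suppose `w x ≤ 2T` with `T` large. By Chebyshev and lower regularity, a ball around `x`
whose radius is about `T^(-p/Q)` contains a point `y` with `w y ≤ T`. As `s p = Q`, the jump `|u x -
u y|` is at most `3 T^η` with `η = O(ε)`: criticality cancels the main power (`exists_step`).
Descending through dyadic levels sums these jumps geometrically, so `|u|` is at most a constant
times `w^η` where `w > 1`. For `ε` small, `η β ≤ p`, hence `|u|^β ≤ D w^p`, and it remains to
integrate (`enorm_rpow_le`).

Log-Hölder continuity enters only as uniform continuity: on small balls `p` and `s` vary by at most
`ε`. -/

/-- A bounded exponent whose reciprocal is log-Hölder continuous is uniformly continuous. -/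
lemma LogHolder.exists_dist_lt {X : Type*} [MetricSpace X] {p : X → ℝ}
    (hp : LogHolder fun x => 1 / p x) (M : ℝ) {ε : ℝ} (hε : 0 < ε) :
    ∃ δ : ℝ, 0 < δ ∧ δ ≤ 1 ∧ ∀ x y, 0 < p x → 0 < p y → p x ≤ M → p y ≤ M →
      dist x y < δ → |p x - p y| ≤ ε := by
  obtain ⟨C, hC, h⟩ := hp
  -- At this distance the logarithm exceeds `C * M ^ 2 / ε`, so the reciprocals differ by at most `ε
  -- / M ^ 2`; multiplying by `p x * p y ≤ M ^ 2` leaves `ε`.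
  refine ⟨Real.exp (-(C * M ^ 2 / ε)), Real.exp_pos _, ?_, fun x y hx hy hxM hyM hd => ?_⟩
  · rw [Real.exp_le_one_iff, neg_nonpos]
    positivity
  rcases eq_or_ne x y with rfl | hxy
  · simpa using hε.le
  have hd0 : 0 < dist x y := dist_pos.2 hxy
  have hM : 0 < M := hx.trans_le hxM
  have h1 : C * M ^ 2 / ε ≤ Real.log (Real.exp 1 + 1 / dist x y) := by
    rw [Real.le_log_iff_exp_le (by positivity)]
    have : Real.exp (C * M ^ 2 / ε) ≤ 1 / dist x y := by
      rw [le_div_iff₀ hd0]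
      calc _ ≤ Real.exp (C * M ^ 2 / ε) * Real.exp (-(C * M ^ 2 / ε)) := by gcongr
        _ = 1 := by rw [← Real.exp_add]; simp
    linarith [Real.exp_pos 1]
  have h2 : 0 < C * M ^ 2 / ε := by positivity
  have h3 := h x y
  have h4 : C / Real.log (Real.exp 1 + 1 / dist x y) ≤ ε / M ^ 2 := by
    rw [div_le_div_iff₀ (h2.trans_le h1) (by positivity)]
    rw [div_le_iff₀ hε] at h1
    linarith
  have h5 : p x - p y = -(p x * p y * (1 / p x - 1 / p y)) := by
    field_simp
    ring
  rw [h5, abs_neg, abs_mul, abs_of_pos (by positivity : 0 < p x * p y)]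
  calc p x * p y * |1 / p x - 1 / p y| ≤ (M * M) * (ε / M ^ 2) := by
        gcongr
        exact h3.trans h4
    _ = ε := by field_simp

/-! ### Pointwise estimate by chaining -/

/-- If a function has small modular compared to a ball, some point of the ball is in a
sublevel set. -/
lemma exists_mem_ball_le {X : Type*} [MetricSpace X] [MeasurableSpace X] [BorelSpace X]
    {μ : Measure X} {p : X → ℝ} {w : X → ℝ≥0∞} {K T : ℝ≥0∞} {N : Set X} (hN : μ N = 0)
    (hK : modular μ p w ≤ K) (hT : 1 ≤ T) {x : X} {r a : ℝ} (ha0 : 0 ≤ a)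
    (ha : ∀ y ∈ Metric.ball x r, y ∉ N → a ≤ p y) (h : K < T ^ a * μ (Metric.ball x r)) :
    ∃ y ∈ Metric.ball x r, y ∉ N ∧ w y ≤ T := by
  -- Chebyshev: if `w > T` on the whole ball off `N`, then `T ^ a * μ(ball)` is at most the modular,
  -- hence at most `K`.
  by_contra! hcon
  refine absurd h (not_lt.2 ?_)
  calc T ^ a * μ (Metric.ball x r) = ∫⁻ _ in Metric.ball x r, T ^ a ∂μ := by
        rw [setLIntegral_const]
    _ ≤ ∫⁻ y in Metric.ball x r, w y ^ p y ∂μ := by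
        refine setLIntegral_mono_ae' Metric.isOpen_ball.measurableSet ?_
        filter_upwards [measure_eq_zero_iff_ae_notMem.1 hN] with y hyN hy
        have hpy := ha y hy hyN
        calc T ^ a ≤ T ^ p y := ENNReal.rpow_le_rpow_of_exponent_le hT hpy
          _ ≤ w y ^ p y := ENNReal.rpow_le_rpow (hcon y hy hyN).le (ha0.trans hpy)
    _ ≤ modular μ p w := setLIntegral_le_lintegral _ _
    _ ≤ K := hK

/-- Exponents and a function `u` with a pointwise gradient of order `s - ε` on scales below `1`,
controlled off the set `N`; the exponents oscillate by at most `ε` on scale `δ`. -/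
structure ChainData {X : Type*} [MetricSpace X] (s p Q : X → ℝ) (u : X → ℝ) (w : X → ℝ≥0∞)
    (N : Set X) (ε δ p₁ s₁ Q₂ : ℝ) : Prop where
  eps_pos : 0 < ε
  delta_le : δ ≤ 1
  two_eps_lt_p : 2 * ε < p₁
  two_eps_lt_s : 2 * ε < s₁
  mul_eq : ∀ x, s x * p x = Q x
  p_ge : ∀ x ∉ N, p₁ ≤ p x
  s_ge : ∀ x ∉ N, s₁ ≤ s x
  Q_le : ∀ x ∉ N, Q x ≤ Q₂
  p_osc : ∀ x ∉ N, ∀ y ∉ N, dist x y < δ → |p x - p y| ≤ ε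
  s_osc : ∀ x ∉ N, ∀ y ∉ N, dist x y < δ → |s x - s y| ≤ ε
  enorm_le : ∀ x, ‖u x‖ₑ ≤ w x
  grad : ∀ x ∉ N, ∀ y ∉ N, dist x y < 1 → ENNReal.ofReal |u x - u y| ≤
    ENNReal.ofReal (dist x y ^ (s x - ε)) * w x + ENNReal.ofReal (dist x y ^ (s y - ε)) * w y

namespace ChainData

variable {X : Type*} [MetricSpace X] {s p Q : X → ℝ} {u : X → ℝ} {w : X → ℝ≥0∞}
    {N : Set X} {ε δ p₁ s₁ Q₂ : ℝ}

/-- One step of the chain: from level `2 * T` to level `T`. -/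
lemma exists_step (hc : ChainData s p Q u w N ε δ p₁ s₁ Q₂) [MeasurableSpace X] [BorelSpace X]
    {μ : Measure X} (hN : μ N = 0) {b K T : ℝ} (hb : 0 < b)
    (hreg : ∀ (x : X) (r : ℝ), 0 < r → r ≤ 1 →
      ENNReal.ofReal (b * r ^ Q x) ≤ μ (Metric.ball x r))
    (hK : modular μ p w ≤ ENNReal.ofReal K) (hT : 1 ≤ T) (hTK : K < b * T ^ ε)
    (hTδ : T ^ (-((p₁ - 2 * ε) / Q₂)) ≤ δ) {x : X} (hx : x ∉ N)
    (hwx : w x ≤ ENNReal.ofReal (2 * T)) :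
    ∃ y ∉ N, w y ≤ ENNReal.ofReal T ∧
      |u x - u y| ≤ 3 * T ^ (ε * (2 / p₁ + 2 / s₁)) := by
  have hε := hc.eps_pos
  have h2p := hc.two_eps_lt_p
  have h2s := hc.two_eps_lt_s
  have hpx := hc.p_ge x hx
  have hsx := hc.s_ge x hx
  have hQx := hc.Q_le x hx
  have hQ : s x * p x = Q x := hc.mul_eq x
  have hp0 : 0 < p x := by linarith
  have hs0 : 0 < s x := by linarith
  have hQ0 : 0 < Q x := hQ ▸ mul_pos hs0 hp0
  have hT0 : 0 < T := by linarith
  -- With `r = T ^ (-θ)` the ball has measure at least `b * T ^ (-(p x - 2 * ε))`. The exponent `p x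
  -- - 2 * ε` replaces `p x` to leave room for the oscillation of `p`.
  set θ : ℝ := (p x - 2 * ε) / Q x with hθ
  have hθle : (p₁ - 2 * ε) / Q₂ ≤ θ :=
    div_le_div₀ (by linarith) (by linarith) hQ0 hQx
  set r : ℝ := T ^ (-θ) with hr
  have hr0 : 0 < r := Real.rpow_pos_of_pos hT0 _
  have hrδ : r ≤ δ := (Real.rpow_le_rpow_of_exponent_le hT (by linarith)).trans hTδ
  have hr1 : r ≤ 1 := hrδ.trans hc.delta_le
  have hrQ : r ^ Q x = T ^ (-(p x - 2 * ε)) := by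
    rw [hr, ← Real.rpow_mul hT0.le, hθ]
    congr 1
    field_simp
  -- On the ball `p ≥ p x - ε`, so the Chebyshev product is at least `b * T ^ ε`, which exceeds `K`
  -- by `hTK`.
  obtain ⟨y, hy, hyN, hwy⟩ := exists_mem_ball_le (μ := μ) (p := p) (w := w)
    (K := ENNReal.ofReal K) (T := ENNReal.ofReal T) (x := x) (r := r) (a := p x - ε) hN hK
    (by simpa using ENNReal.ofReal_le_ofReal hT) (by linarith)
    (fun y hy hyN => by
      rw [Metric.mem_ball, dist_comm] at hy
      linarith [(abs_le.1 (hc.p_osc x hx y hyN (hy.trans_le hrδ))).2]) (by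
      refine lt_of_lt_of_le ?_ (mul_le_mul_right (hreg x r hr0 hr1) _)
      rw [ENNReal.ofReal_rpow_of_pos hT0, ← ENNReal.ofReal_mul (by positivity),
        ENNReal.ofReal_lt_ofReal_iff (by positivity), hrQ]
      calc K < b * T ^ ε := hTK
        _ = T ^ (p x - ε) * (b * T ^ (-(p x - 2 * ε))) := by
          rw [mul_left_comm, ← Real.rpow_add hT0]
          congr 2
          ring)
  refine ⟨y, hyN, hwy, ?_⟩
  rw [Metric.mem_ball, dist_comm] at hy
  have hsy := (abs_le.1 (hc.s_osc x hx y hyN (hy.trans_le hrδ))).2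
  have hpow : ∀ a, s x - 2 * ε ≤ a → dist x y ^ a ≤ r ^ (s x - 2 * ε) := fun a ha =>
    (Real.rpow_le_rpow dist_nonneg hy.le (by linarith)).trans
      (Real.rpow_le_rpow_of_exponent_ge hr0 hr1 ha)
  have hrs : T * r ^ (s x - 2 * ε) ≤ T ^ (ε * (2 / p₁ + 2 / s₁)) := by
    rw [hr, ← Real.rpow_mul hT0.le]
    nth_rewrite 1 [← Real.rpow_one T]
    rw [← Real.rpow_add hT0]
    refine Real.rpow_le_rpow_of_exponent_le hT ?_
    -- Criticality `s p = Q` is decisive here: the terms of order zero in `ε` cancel.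
    have e1 : 1 + -θ * (s x - 2 * ε) = ε * (2 / p x + 2 / s x) - 4 * ε ^ 2 / (s x * p x) := by
      rw [hθ, ← hQ]
      field_simp
      ring
    have e2 : 0 ≤ 4 * ε ^ 2 / (s x * p x) := by positivity
    have e3 : ε * (2 / p x + 2 / s x) ≤ ε * (2 / p₁ + 2 / s₁) := by
      have : 0 < p₁ := by linarith
      have : 0 < s₁ := by linarith
      gcongr
    linarith
  have hfin : ENNReal.ofReal |u x - u y| ≤ ENNReal.ofReal (3 * (T * r ^ (s x - 2 * ε))) := by
    have hR : (0 : ℝ) ≤ r ^ (s x - 2 * ε) := by positivity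
    calc _ ≤ _ := hc.grad x hx y hyN (hy.trans_le hr1)
      _ ≤ ENNReal.ofReal (r ^ (s x - 2 * ε)) * ENNReal.ofReal (2 * T) +
          ENNReal.ofReal (r ^ (s x - 2 * ε)) * ENNReal.ofReal T := by
        gcongr
        · exact hpow _ (by linarith)
        · exact hpow _ (by linarith)
      _ = _ := by
        rw [← ENNReal.ofReal_mul hR, ← ENNReal.ofReal_mul hR,
          ← ENNReal.ofReal_add (by positivity) (by positivity)]
        congr 1
        ring
  rw [ENNReal.ofReal_le_ofReal_iff (by positivity)] at hfin
  linarith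

/-- Growth bound on sublevel sets obtained by iterating the chain. -/
lemma abs_le_of_le (hc : ChainData s p Q u w N ε δ p₁ s₁ Q₂) [MeasurableSpace X] [BorelSpace X]
    {μ : Measure X} (hN : μ N = 0) {b K T A : ℝ} (hb : 0 < b)
    (hreg : ∀ (x : X) (r : ℝ), 0 < r → r ≤ 1 →
      ENNReal.ofReal (b * r ^ Q x) ≤ μ (Metric.ball x r))
    (hK : modular μ p w ≤ ENNReal.ofReal K) (hT : 1 ≤ T) (hTK : K < b * T ^ ε)
    (hTδ : T ^ (-((p₁ - 2 * ε) / Q₂)) ≤ δ) (hQ₂ : 0 < Q₂)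
    (hTA : T ≤ A) (hA : 3 ≤ A * (2 ^ (ε * (2 / p₁ + 2 / s₁)) - 1)) (n : ℕ) :
    ∀ x ∉ N, w x ≤ ENNReal.ofReal (T * 2 ^ n) →
      |u x| ≤ A * (T * 2 ^ n) ^ (ε * (2 / p₁ + 2 / s₁)) := by
  have hε := hc.eps_pos
  have h2p := hc.two_eps_lt_p
  have hp₁ : 0 < p₁ := by linarith
  have hs₁ : 0 < s₁ := by linarith [hc.two_eps_lt_s]
  set η := ε * (2 / p₁ + 2 / s₁) with hη
  have hη0 : 0 < η := by positivity
  induction n with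
  | zero =>
    intro x _ hwx
    have h1 : ‖u x‖ₑ ≤ ENNReal.ofReal T := by simpa using (hc.enorm_le x).trans hwx
    rw [Real.enorm_eq_ofReal_abs, ENNReal.ofReal_le_ofReal_iff (by linarith)] at h1
    have h2 : 1 ≤ T ^ η := Real.one_le_rpow hT hη0.le
    simp only [pow_zero, mul_one]
    nlinarith
  | succ n ih =>
    intro x hx hwx
    have hT' : T ≤ T * 2 ^ n := le_mul_of_one_le_right (by linarith) (one_le_pow₀ (by norm_num))
    have hT0 : 0 < T := by linarith
    obtain ⟨y, hy, hwy, hxy⟩ := hc.exists_step hN (T := T * 2 ^ n) hb hreg hK (hT.trans hT')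
      (hTK.trans_le (by gcongr))
      (le_trans (Real.rpow_le_rpow_of_nonpos hT0 hT' (by
        rw [neg_nonpos]
        exact div_nonneg (by linarith) hQ₂.le)) hTδ) hx
      (by rw [pow_succ] at hwx; convert hwx using 2; ring)
    have h1 := ih y hy hwy
    have h2 : |u x| ≤ |u y| + |u x - u y| := by
      have := abs_add_le (u y) (u x - u y)
      simpa using this
    have h3 : (T * 2 ^ (n + 1)) ^ η = 2 ^ η * (T * 2 ^ n) ^ η := by
      rw [← Real.mul_rpow (by norm_num) (by positivity)]
      congr 1
      ring
    rw [h3]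
    have h4 : 0 < (T * 2 ^ n) ^ η := by positivity
    -- The new jump is absorbed because `A + 3 ≤ A * 2 ^ η`, which is `hA`.
    nlinarith

/-- The pointwise bound of `|u| ^ β` by `w ^ p`. -/
lemma enorm_rpow_le (hc : ChainData s p Q u w N ε δ p₁ s₁ Q₂) [MeasurableSpace X] [BorelSpace X]
    {μ : Measure X} (hN : μ N = 0) {b K T A β₂ : ℝ} (hb : 0 < b)
    (hreg : ∀ (x : X) (r : ℝ), 0 < r → r ≤ 1 →
      ENNReal.ofReal (b * r ^ Q x) ≤ μ (Metric.ball x r))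
    (hK : modular μ p w ≤ ENNReal.ofReal K) (hT : 1 ≤ T) (hTK : K < b * T ^ ε)
    (hTδ : T ^ (-((p₁ - 2 * ε) / Q₂)) ≤ δ) (hQ₂ : 0 < Q₂)
    (hTA : T ≤ A) (hA : 3 ≤ A * (2 ^ (ε * (2 / p₁ + 2 / s₁)) - 1))
    (hηβ : ε * (2 / p₁ + 2 / s₁) * β₂ ≤ p₁) {x : X} (hx : x ∉ N) {B : ℝ} (hpB : p x ≤ B)
    (hBβ : B ≤ β₂) :
    ‖u x‖ₑ ^ B ≤ ENNReal.ofReal ((A * (2 * T) ^ (ε * (2 / p₁ + 2 / s₁))) ^ β₂) * w x ^ p x := by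
  have hε := hc.eps_pos
  have h2p := hc.two_eps_lt_p
  have hp₁ : 0 < p₁ := by linarith
  have hs₁ : 0 < s₁ := by linarith [hc.two_eps_lt_s]
  have hpx := hc.p_ge x hx
  have hT0 : 0 < T := by linarith
  have hA0 : 0 < A := by linarith
  set η := ε * (2 / p₁ + 2 / s₁) with hη
  have hη0 : 0 < η := by positivity
  have hC1 : 1 ≤ A * (2 * T) ^ η :=
    one_le_mul_of_one_le_of_one_le (hT.trans hTA) (Real.one_le_rpow (by linarith) hη0.le)
  have hC2 : 1 ≤ ENNReal.ofReal ((A * (2 * T) ^ η) ^ β₂) := by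
    rw [ENNReal.one_le_ofReal]
    exact Real.one_le_rpow hC1 (by linarith)
  have hu := hc.enorm_le x
  -- Where `w ≤ 1` also `|u| ≤ 1`, and raising the exponent from `p x` to `B` only helps; chaining
  -- is needed only for `w > 1`.
  rcases le_or_gt (w x) 1 with hw | hw
  · calc ‖u x‖ₑ ^ B ≤ ‖u x‖ₑ ^ p x := ENNReal.rpow_le_rpow_of_exponent_ge (hu.trans hw) hpB
      _ ≤ w x ^ p x := ENNReal.rpow_le_rpow hu (by linarith)
      _ ≤ _ := le_mul_of_one_le_left zero_le hC2
  rcases eq_or_ne (w x) ∞ with htop | htop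
  · rw [htop, ENNReal.top_rpow_of_pos (by linarith), ENNReal.mul_top (by positivity)]
    exact le_top
  obtain ⟨W, hW⟩ : ∃ W : ℝ, W = (w x).toReal := ⟨_, rfl⟩
  have hwW : w x = ENNReal.ofReal W := by rw [hW, ENNReal.ofReal_toReal htop]
  have hW1 : 1 < W := by
    rwa [hwW, ENNReal.one_lt_ofReal] at hw
  -- The level `T * 2 ^ (n + 1)` lies above `W`, yet is at most `2 * T * W`; this is the origin of
  -- the factor `2 * T` in the constant.
  obtain ⟨n, hn1, hn2⟩ := exists_nat_pow_near hW1.le (one_lt_two : (1 : ℝ) < 2)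
  have h1 := hc.abs_le_of_le hN hb hreg hK hT hTK hTδ hQ₂ hTA hA (n + 1) x hx (by
    rw [hwW]
    refine ENNReal.ofReal_le_ofReal (hn2.le.trans ?_)
    exact le_mul_of_one_le_left (by positivity) hT)
  have h2 : |u x| ≤ A * (2 * T) ^ η * W ^ η := by
    refine h1.trans ?_
    rw [mul_assoc, ← Real.mul_rpow (by positivity) (by linarith)]
    have : T * 2 ^ (n + 1) ≤ 2 * T * W := by
      rw [pow_succ]
      nlinarith
    gcongr
  have hB0 : 0 ≤ B := by linarith
  have hW0 : 0 < W := by linarith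
  rw [Real.enorm_eq_ofReal_abs, hwW, ENNReal.ofReal_rpow_of_pos hW0,
    ENNReal.ofReal_rpow_of_nonneg (abs_nonneg _) hB0, ← ENNReal.ofReal_mul (by positivity)]
  refine ENNReal.ofReal_le_ofReal ?_
  calc |u x| ^ B ≤ (A * (2 * T) ^ η * W ^ η) ^ B := Real.rpow_le_rpow (abs_nonneg _) h2 hB0
    _ = (A * (2 * T) ^ η) ^ B * W ^ (η * B) := by
      rw [Real.mul_rpow (by positivity) (by positivity), ← Real.rpow_mul hW0.le]
    _ ≤ (A * (2 * T) ^ η) ^ β₂ * W ^ p x := by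
      have h3 : η * B ≤ p x := le_trans (by gcongr) (hηβ.trans hpx)
      gcongr
      exact hW1.le

end ChainData
-- Regularised gradient and the uniform modular estimate
/-- A scale-summed pointwise gradient of order `s - ε` built from a vector gradient. -/
lemma vectorGradient_le_iSup {X : Type*} [MetricSpace X] {s u : X → ℝ} {g : ℤ → X → ℝ≥0∞} {ε : ℝ}
    (hε : 0 < ε) {x y : X} (hg : ∀ k : ℤ,
      (2 : ℝ) ^ (-k - 1) ≤ dist x y → dist x y < (2 : ℝ) ^ (-k) →
      ENNReal.ofReal |u x - u y| ≤
        ENNReal.ofReal (dist x y ^ s x) * g k x + ENNReal.ofReal (dist x y ^ s y) * g k y)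
    (hd : dist x y < 1) :
    ENNReal.ofReal |u x - u y| ≤
      ENNReal.ofReal (dist x y ^ (s x - ε)) *
        (⨆ k : ℕ, ENNReal.ofReal ((2 : ℝ) ^ (-ε)) ^ k * g k x) +
      ENNReal.ofReal (dist x y ^ (s y - ε)) *
        (⨆ k : ℕ, ENNReal.ofReal ((2 : ℝ) ^ (-ε)) ^ k * g k y) := by
  rcases eq_or_ne x y with rfl | hxy
  · simp
  have hd0 : 0 < dist x y := dist_pos.2 hxy
  obtain ⟨n, hn1, hn2⟩ := exists_mem_Ico_zpow hd0 (one_lt_two : (1 : ℝ) < 2)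
  have hn : n < 0 := by
    by_contra! h
    exact absurd (hn1.trans_lt hd) (not_lt.2 (one_le_zpow₀ (by norm_num) h))
  -- From `2 ^ n ≤ d < 2 ^ (n + 1)` the gradient index is `-n - 1`. It is nonnegative because `d <
  -- 1`, so a supremum over `ℕ` suffices.
  obtain ⟨k, hk⟩ := Int.eq_ofNat_of_zero_le (by omega : 0 ≤ -n - 1)
  have hk2 : dist x y < (2 : ℝ) ^ (-(k : ℤ)) := by
    rwa [← hk, show -(-n - 1) = n + 1 by ring]
  have key : ∀ z, ENNReal.ofReal (dist x y ^ s z) * g k z ≤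
      ENNReal.ofReal (dist x y ^ (s z - ε)) *
        (⨆ k : ℕ, ENNReal.ofReal ((2 : ℝ) ^ (-ε)) ^ k * g k z) := by
    intro z
    have h1 : dist x y ^ ε ≤ ((2 : ℝ) ^ (-ε)) ^ k := by
      calc dist x y ^ ε ≤ ((2 : ℝ) ^ (-(k : ℤ))) ^ ε :=
            Real.rpow_le_rpow hd0.le hk2.le hε.le
        _ = ((2 : ℝ) ^ (-ε)) ^ k := by
          rw [← Real.rpow_intCast, ← Real.rpow_mul (by norm_num), ← Real.rpow_natCast,
            ← Real.rpow_mul (by norm_num)]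
          congr 1
          push_cast
          ring
    calc ENNReal.ofReal (dist x y ^ s z) * g k z
        = ENNReal.ofReal (dist x y ^ (s z - ε)) * (ENNReal.ofReal (dist x y ^ ε) * g k z) := by
          rw [← mul_assoc, ← ENNReal.ofReal_mul (by positivity), ← Real.rpow_add hd0]
          simp
      _ ≤ ENNReal.ofReal (dist x y ^ (s z - ε)) *
          (ENNReal.ofReal ((2 : ℝ) ^ (-ε)) ^ k * g k z) := by
          gcongr
          rw [← ENNReal.ofReal_pow (by positivity)]
          exact ENNReal.ofReal_le_ofReal h1
      _ ≤ _ := by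
          gcongr
          exact le_iSup (fun k : ℕ => ENNReal.ofReal ((2 : ℝ) ^ (-ε)) ^ k * g k z) k
  refine (hg k ?_ hk2).trans (add_le_add (key x) (key y))
  rwa [← hk, show -(-n - 1) - 1 = n by ring]

/-- The modular of the maximum of `u` and of a geometrically weighted supremum. -/
lemma modular_max_iSup_le {X : Type*} [MeasurableSpace X] {μ : Measure X} {p : X → ℝ}
    (hp : IsBddExponent μ p) {p₁ : ℝ} (hp₁ : ∀ᵐ x ∂μ, p₁ ≤ p x) {c : ℝ≥0∞}
    (hc : c ≤ 1) {f : X → ℝ≥0∞} (hf : Measurable f) {g : ℕ → X → ℝ≥0∞}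
    (hg : ∀ k, Measurable (g k)) (hf1 : modular μ p f ≤ 1) (hg1 : ∀ k, modular μ p (g k) ≤ 1) :
    modular μ p (fun x => max (f x) (⨆ k, c ^ k * g k x)) ≤ 1 + (1 - c ^ p₁)⁻¹ := by
  have hpm := hp.measurable
  have hpt : ∀ᵐ x ∂μ, (max (f x) (⨆ k, c ^ k * g k x)) ^ p x ≤
      f x ^ p x + ∑' k, (c ^ p₁) ^ k * g k x ^ p x := by
    filter_upwards [hp₁] with x hx
    have hx0 := hp.pos x
    rw [(ENNReal.monotone_rpow_of_nonneg hx0.le).map_max]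
    refine max_le le_self_add (le_trans ?_ le_add_self)
    have : (⨆ k, c ^ k * g k x) ^ p x = ⨆ k, (c ^ k * g k x) ^ p x :=
      (ENNReal.orderIsoRpow (p x) hx0).map_iSup _
    rw [this]
    -- The supremum is bounded by the sum over `k`; as `c ≤ 1` and `p₁ ≤ p x`, the weights are at
    -- most powers of the constant ratio `c ^ p₁`.
    refine iSup_le fun k => le_trans ?_ (ENNReal.le_tsum k)
    rw [ENNReal.mul_rpow_of_nonneg _ _ hx0.le, ← ENNReal.rpow_natCast, ← ENNReal.rpow_natCast,
      ← ENNReal.rpow_mul, ← ENNReal.rpow_mul]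
    gcongr ?_ * _
    refine ENNReal.rpow_le_rpow_of_exponent_ge hc ?_
    rw [mul_comm p₁]
    gcongr
  calc _ ≤ ∫⁻ x, f x ^ p x + ∑' k, (c ^ p₁) ^ k * g k x ^ p x ∂μ := lintegral_mono_ae hpt
    _ = modular μ p f + ∑' k, (c ^ p₁) ^ k * modular μ p (g k) := by
      rw [lintegral_add_left (by fun_prop), lintegral_tsum (fun k => by fun_prop)]
      congr 2
      ext k
      rw [lintegral_const_mul _ (by fun_prop)]
      rfl
    _ ≤ 1 + ∑' k, (c ^ p₁) ^ k * 1 := by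
      gcongr with k
      exact hg1 k
    _ = _ := by simp [ENNReal.tsum_geometric]

/-- Uniform modular estimate: a critical vector gradient with uniformly bounded modulars controls
the modular of every bounded exponent above `p`. -/
theorem exists_modular_le {X : Type*} [MetricSpace X] [MeasurableSpace X] [BorelSpace X]
    {μ : Measure X} {Q p s : X → ℝ} (hreg : LowerAhlforsRegular μ Q) (hp : IsLogExponent μ p)
    (hs : IsLogExponent μ s) (hspQ : ∀ x, s x * p x = Q x) {β : X → ℝ} {β₂ : ℝ}
    (hpβ : ∀ᵐ x ∂μ, p x ≤ β x) (hβ₂ : ∀ᵐ x ∂μ, β x ≤ β₂) :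
    ∃ K : ℝ≥0, 1 ≤ K ∧ ∀ u : X → ℝ, Measurable u → ∀ g ∈ vectorGradients μ s u,
      modular μ p (fun x => ‖u x‖ₑ) ≤ 1 → (∀ k, modular μ p (g k) ≤ 1) →
      modular μ β (fun x => ‖u x‖ₑ) ≤ K := by
  obtain ⟨b, hb, hreg⟩ := hreg
  obtain ⟨p₁, hp₁0, hp₁⟩ := hp.bdd_below
  obtain ⟨p₂, hp₂⟩ := hp.bdd_above
  obtain ⟨s₁, hs₁0, hs₁⟩ := hs.bdd_below
  obtain ⟨s₂, hs₂⟩ := hs.bdd_above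
  -- An almost-everywhere upper bound can be any real number when `μ = 0`; the maximum with 1 makes
  -- it positive.
  have hp₂' : ∀ᵐ x ∂μ, p x ≤ max p₂ 1 := hp₂.mono fun x hx => hx.trans (le_max_left _ _)
  have hs₂' : ∀ᵐ x ∂μ, s x ≤ max s₂ 1 := hs₂.mono fun x hx => hx.trans (le_max_left _ _)
  have hβ₂' : ∀ᵐ x ∂μ, β x ≤ max β₂ 1 := hβ₂.mono fun x hx => hx.trans (le_max_left _ _)
  have hp₂0 : 0 < max p₂ 1 := lt_max_of_lt_right one_pos
  have hs₂0 : 0 < max s₂ 1 := lt_max_of_lt_right one_pos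
  have hβ₂0 : 0 < max β₂ 1 := lt_max_of_lt_right one_pos
  generalize max p₂ 1 = P₂ at hp₂' hp₂0
  generalize max s₂ 1 = S₂ at hs₂' hs₂0
  generalize max β₂ 1 = B₂ at hβ₂' hβ₂0
  have hη0 : 0 < 2 / p₁ + 2 / s₁ := by positivity
  -- The last condition is `η * B₂ ≤ p₁`, which converts the growth `w ^ η` of `u` into `w ^ p`.
  obtain ⟨ε, hε, hε1, hε2, hε3⟩ : ∃ ε : ℝ, 0 < ε ∧ 2 * ε < p₁ ∧ 2 * ε < s₁ ∧
      ε * (2 / p₁ + 2 / s₁) * B₂ ≤ p₁ := by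
    refine ⟨min (min (p₁ / 3) (s₁ / 3)) (p₁ / ((2 / p₁ + 2 / s₁) * B₂)), by positivity, ?_, ?_, ?_⟩
    · have := (min_le_left (min (p₁ / 3) (s₁ / 3)) (p₁ / ((2 / p₁ + 2 / s₁) * B₂))).trans
        (min_le_left _ _)
      linarith
    · have := (min_le_left (min (p₁ / 3) (s₁ / 3)) (p₁ / ((2 / p₁ + 2 / s₁) * B₂))).trans
        (min_le_right _ _)
      linarith
    · rw [mul_assoc, ← le_div_iff₀ (by positivity)]
      exact min_le_right _ _
  obtain ⟨δp, hδp0, hδp1, hδp⟩ := hp.logHolder.exists_dist_lt P₂ hε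
  obtain ⟨δs, hδs0, hδs1, hδs⟩ := hs.logHolder.exists_dist_lt S₂ hε
  set δ := min δp δs with hδ
  have hδ0 : 0 < δ := lt_min hδp0 hδs0
  set c : ℝ≥0∞ := ENNReal.ofReal ((2 : ℝ) ^ (-ε)) with hcdef
  have hc1 : c < 1 := by
    rw [hcdef, ENNReal.ofReal_lt_one]
    exact Real.rpow_lt_one_of_one_lt_of_neg one_lt_two (by linarith)
  have hcp : c ^ p₁ < 1 := ENNReal.rpow_lt_one hc1 hp₁0
  have hKfin : 1 + (1 - c ^ p₁)⁻¹ ≠ ∞ := by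
    simp [(tsub_pos_of_lt hcp).ne']
  set K : ℝ := (1 + (1 - c ^ p₁)⁻¹).toReal with hKdef
  have hKof : 1 + (1 - c ^ p₁)⁻¹ = ENNReal.ofReal K := (ENNReal.ofReal_toReal hKfin).symm
  have hQ₂0 : 0 < S₂ * P₂ := by positivity
  obtain ⟨T, hT1, hTK, hTδ⟩ : ∃ T : ℝ, 1 ≤ T ∧ K < b * T ^ ε ∧
      T ^ (-((p₁ - 2 * ε) / (S₂ * P₂))) ≤ δ := by
    -- Both requirements hold for all large `T`, and neither `K` nor `δ` depends on `u`.
    have h1 := ((tendsto_rpow_atTop hε).const_mul_atTop hb).eventually_gt_atTop K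
    have h2 := (tendsto_rpow_neg_atTop
      (div_pos (by linarith : 0 < p₁ - 2 * ε) hQ₂0)).eventually_le_const hδ0
    exact ((Filter.eventually_ge_atTop 1).and (h1.and h2)).exists
  set η := ε * (2 / p₁ + 2 / s₁) with hη
  have hη1 : 0 < (2 : ℝ) ^ η - 1 := by
    rw [sub_pos]
    exact Real.one_lt_rpow one_lt_two (by positivity)
  set A := max T (3 / ((2 : ℝ) ^ η - 1)) with hAdef
  have hA : 3 ≤ A * ((2 : ℝ) ^ η - 1) := by
    rw [← div_le_iff₀ hη1]
    exact le_max_right _ _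
  set D : ℝ := (A * (2 * T) ^ η) ^ B₂ with hD
  refine ⟨max 1 (D.toNNReal * K.toNNReal), le_max_left _ _, fun u hu g hg hu1 hg1 => ?_⟩
  obtain ⟨hgm, N, hN, hgN⟩ := hg
  set w : X → ℝ≥0∞ := fun x => max ‖u x‖ₑ (⨆ k : ℕ, c ^ k * g k x) with hw
  have hwK : modular μ p w ≤ ENNReal.ofReal K := by
    rw [← hKof]
    exact modular_max_iSup_le hp.toIsBddExponent hp₁ hc1.le (by fun_prop) (fun k => hgm k) hu1
      (fun k => hg1 k)
  have hall : ∀ᵐ x ∂μ, x ∉ N ∧ p₁ ≤ p x ∧ p x ≤ P₂ ∧ s₁ ≤ s x ∧ s x ≤ S₂ := by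
    filter_upwards [measure_eq_zero_iff_ae_notMem.1 hN, hp₁, hp₂', hs₁, hs₂'] with x h1 h2 h3 h4 h5
    exact ⟨h1, h2, h3, h4, h5⟩
  obtain ⟨N', hN', hmem⟩ : ∃ N' : Set X, μ N' = 0 ∧
      ∀ x ∉ N', x ∉ N ∧ p₁ ≤ p x ∧ p x ≤ P₂ ∧ s₁ ≤ s x ∧ s x ≤ S₂ :=
    ⟨_, ae_iff.1 hall, fun x hx => not_not.1 hx⟩
  have hchain : ChainData s p Q u w N' ε δ p₁ s₁ (S₂ * P₂) :=
    { eps_pos := hε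
      delta_le := (min_le_left _ _).trans hδp1
      two_eps_lt_p := hε1
      two_eps_lt_s := hε2
      mul_eq := hspQ
      p_ge := fun x hx => (hmem x hx).2.1
      s_ge := fun x hx => (hmem x hx).2.2.2.1
      Q_le := fun x hx => by
        rw [← hspQ]
        exact mul_le_mul (hmem x hx).2.2.2.2 (hmem x hx).2.2.1 (hp.pos x).le hs₂0.le
      p_osc := fun x hx y hy h => hδp x y (hp.pos x) (hp.pos y) (hmem x hx).2.2.1
        (hmem y hy).2.2.1 (h.trans_le (min_le_left _ _))
      s_osc := fun x hx y hy h => hδs x y (hs.pos x) (hs.pos y) (hmem x hx).2.2.2.2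
        (hmem y hy).2.2.2.2 (h.trans_le (min_le_right _ _))
      enorm_le := fun x => le_max_left _ _
      grad := fun x hx y hy h => by
        refine (vectorGradient_le_iSup hε
          (fun k => hgN k x y (hmem x hx).1 (hmem y hy).1) h).trans ?_
        gcongr
        · exact le_max_right _ _
        · exact le_max_right _ _ }
  calc modular μ β (fun x => ‖u x‖ₑ) ≤ ∫⁻ x, ENNReal.ofReal D * w x ^ p x ∂μ := by
        refine lintegral_mono_ae ?_
        filter_upwards [measure_eq_zero_iff_ae_notMem.1 hN', hpβ, hβ₂'] with x hx h1 h2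
        exact hchain.enorm_rpow_le hN' hb hreg hwK hT1 hTK hTδ hQ₂0 (le_max_left _ _) hA hε3 hx h1 h2
    _ = ENNReal.ofReal D * modular μ p w := by
      rw [lintegral_const_mul' _ _ ENNReal.ofReal_ne_top]
      rfl
    _ ≤ ENNReal.ofReal D * ENNReal.ofReal K := by gcongr
    _ = ((D.toNNReal * K.toNNReal : ℝ≥0) : ℝ≥0∞) := by
      rw [ENNReal.coe_mul]
      rfl
    _ ≤ _ := by
      gcongr
      exact le_max_right _ _

/-! ### Modulars and quasi-norms -/

section Modular

variable {X : Type*} [MeasurableSpace X] {μ : Measure X} {p : X → ℝ}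

lemma modular_mono (hp : ∀ᵐ x ∂μ, 0 ≤ p x) {f g : X → ℝ≥0∞} (h : ∀ᵐ x ∂μ, f x ≤ g x) :
    modular μ p f ≤ modular μ p g :=
  lintegral_mono_ae (by
    filter_upwards [hp, h] with x hx hfg
    exact ENNReal.rpow_le_rpow hfg hx)

lemma coe_mul_div_eq (a : ℝ≥0∞) {b c : ℝ≥0} (hb : 0 < b) :
    a / ((b * c : ℝ≥0) : ℝ≥0∞) = a / c / b := by
  rw [ENNReal.coe_mul, div_eq_mul_inv, div_eq_mul_inv, div_eq_mul_inv,
    ENNReal.mul_inv (Or.inl (by exact_mod_cast hb.ne')) (Or.inl ENNReal.coe_ne_top), mul_assoc,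
    mul_comm (b : ℝ≥0∞)⁻¹]

/-- A bounded modular is normalised by a power of the bound. -/
lemma modular_div_le_one {p₁ : ℝ} (hp₁0 : 0 < p₁) (hp₁ : ∀ᵐ x ∂μ, p₁ ≤ p x) {f : X → ℝ≥0∞}
    {K : ℝ≥0} (hK : 1 ≤ K) (hf : modular μ p f ≤ K) :
    modular μ p (fun x => f x / (K ^ (1 / p₁) : ℝ≥0)) ≤ 1 := by
  have hK0 : K ≠ 0 := (zero_lt_one.trans_le hK).ne'
  -- The normalising factor is at most 1, so its power `p x` is at most its power `p₁`, which is
  -- exactly `K⁻¹`.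
  have hC1 : ((K ^ (1 / p₁) : ℝ≥0) : ℝ≥0∞)⁻¹ ≤ 1 := by
    rw [ENNReal.inv_le_one]
    exact_mod_cast NNReal.one_le_rpow hK (by positivity)
  have hC2 : ((K ^ (1 / p₁) : ℝ≥0) : ℝ≥0∞)⁻¹ ^ p₁ = (K : ℝ≥0∞)⁻¹ := by
    rw [ENNReal.inv_rpow, ENNReal.coe_rpow_of_ne_zero hK0, ← ENNReal.rpow_mul,
      one_div_mul_cancel hp₁0.ne', ENNReal.rpow_one]
  calc _ ≤ ∫⁻ x, (K : ℝ≥0∞)⁻¹ * f x ^ p x ∂μ := by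
        refine lintegral_mono_ae ?_
        filter_upwards [hp₁] with x hx
        rw [ENNReal.div_eq_inv_mul, ENNReal.mul_rpow_of_nonneg _ _ (hp₁0.le.trans hx), ← hC2]
        gcongr ?_ * _
        exact ENNReal.rpow_le_rpow_of_exponent_ge hC1 hx
    _ = (K : ℝ≥0∞)⁻¹ * modular μ p f := lintegral_const_mul' _ _ (by simpa using hK0)
    _ ≤ (K : ℝ≥0∞)⁻¹ * K := by gcongr
    _ = 1 := ENNReal.inv_mul_cancel (by exact_mod_cast hK0) ENNReal.coe_ne_top

/-- Finiteness of the modular is invariant under dilations for bounded exponents. -/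
lemma modular_lt_top_of_div {p₂ : ℝ} (hp : ∀ᵐ x ∂μ, 0 ≤ p x) (hp₂ : ∀ᵐ x ∂μ, p x ≤ p₂)
    {f : X → ℝ≥0∞} {l : ℝ≥0} (hl : 0 < l) (hf : modular μ p (fun x => f x / l) < ∞) :
    modular μ p f < ∞ := by
  -- Replacing `l` by `max l 1` makes the power increasing in the exponent, so `p₂` bounds it
  -- uniformly.
  have h1 : 1 ≤ max (l : ℝ≥0∞) 1 := le_max_right _ _
  have h2 : max (l : ℝ≥0∞) 1 ^ p₂ ≠ ∞ :=
    ENNReal.rpow_ne_top_of_ne_zero (zero_lt_one.trans_le h1).ne' (by simp)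
  calc modular μ p f ≤ ∫⁻ x, max (l : ℝ≥0∞) 1 ^ p₂ * (f x / l) ^ p x ∂μ := by
        refine lintegral_mono_ae ?_
        filter_upwards [hp, hp₂] with x hx0 hx
        calc f x ^ p x = (l * (f x / l)) ^ p x := by
              rw [ENNReal.mul_div_cancel (by exact_mod_cast hl.ne') ENNReal.coe_ne_top]
          _ = (l : ℝ≥0∞) ^ p x * (f x / l) ^ p x := ENNReal.mul_rpow_of_nonneg _ _ hx0
          _ ≤ _ := by
              gcongr ?_ * _
              exact (ENNReal.rpow_le_rpow (le_max_left _ _) hx0).trans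
                (ENNReal.rpow_le_rpow_of_exponent_le h1 hx)
    _ = max (l : ℝ≥0∞) 1 ^ p₂ * modular μ p (fun x => f x / l) := lintegral_const_mul' _ _ h2
    _ < ∞ := ENNReal.mul_lt_top h2.lt_top hf

lemma modular_div_le_one_of_luxNorm_lt (hp : ∀ᵐ x ∂μ, 0 ≤ p x) {f : X → ℝ≥0∞} {l : ℝ≥0}
    (h : luxNorm μ p f < l) : modular μ p (fun x => f x / l) ≤ 1 := by
  simp only [luxNorm, iInf_lt_iff] at h
  obtain ⟨m, ⟨_, hm⟩, hml⟩ := h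
  exact (modular_mono hp (.of_forall fun x => ENNReal.div_le_div_left hml.le _)).trans hm

/-- This is all that the Triebel–Lizorkin case needs from the inner quasi-norm, which is why every
`q` is allowed there. -/
lemma le_seqNorm {q : ℝ≥0∞} (hq : 0 < q) (a : ℤ → ℝ≥0∞) (k : ℤ) : a k ≤ seqNorm q a := by
  unfold seqNorm
  split_ifs with h
  · exact le_iSup a k
  · have hq' : 0 < q.toReal := ENNReal.toReal_pos hq.ne' h
    calc a k = (a k ^ q.toReal) ^ (1 / q.toReal) := by
          rw [← ENNReal.rpow_mul, mul_one_div_cancel hq'.ne', ENNReal.rpow_one]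
      _ ≤ _ := by
          gcongr
          exact ENNReal.le_tsum (f := fun k => a k ^ q.toReal) k

lemma modular_div_le_one_of_lpSeqNorm_lt (hp : ∀ᵐ x ∂μ, 0 ≤ p x) {q : X → ℝ≥0∞}
    (hq : IsExponent μ q) {g : ℤ → X → ℝ≥0∞} {l : ℝ≥0} (h : lpSeqNorm μ p q g < l) (k : ℤ) :
    modular μ p (fun x => g k x / l) ≤ 1 :=
  (modular_mono hp (.of_forall fun x => ENNReal.div_le_div_right
    (le_seqNorm (hq.pos x) (fun k => g k x) k) _)).trans (modular_div_le_one_of_luxNorm_lt hp h)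

/-- A single term of the series defining the semi-modular is at most 1. Its infimum need not be
attained, so an admissible value `a < 2` is taken; the factor `a ^ (1 / q x)` is then at most `2` to
the reciprocal of `essInf q`, uniformly in `x` and `k`. -/
lemma modular_div_le_one_of_seqLpNorm_lt (hp : ∀ᵐ x ∂μ, 0 ≤ p x) {q : X → ℝ≥0∞}
    (hq : IsExponent μ q) {g : ℤ → X → ℝ≥0∞} {l : ℝ≥0} (h : seqLpNorm μ p q g < l) (k : ℤ) :
    modular μ p (fun x => g k x / ((2 ^ ((essInf q μ)⁻¹).toReal * l : ℝ≥0) : ℝ≥0∞)) ≤ 1 := by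
  simp only [seqLpNorm, iInf_lt_iff] at h
  obtain ⟨m, ⟨_, hm⟩, hml⟩ := h
  have h1 := ((ENNReal.le_tsum k).trans hm).trans_lt ENNReal.one_lt_two
  simp only [iInf_lt_iff] at h1
  obtain ⟨a, ⟨_, ha⟩, ha2⟩ := h1
  refine (modular_mono hp ?_).trans ha
  filter_upwards [ae_essInf_le (μ := μ) (f := q)] with x hx
  rw [coe_mul_div_eq _ (by positivity)]
  refine ENNReal.div_le_div (ENNReal.div_le_div_left hml.le _) ?_
  rw [ENNReal.coe_rpow_of_ne_zero two_ne_zero]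
  calc (a : ℝ≥0∞) ^ ((q x)⁻¹).toReal ≤ 2 ^ ((q x)⁻¹).toReal := by
        gcongr
    _ ≤ 2 ^ ((essInf q μ)⁻¹).toReal := by
        refine ENNReal.rpow_le_rpow_of_exponent_le (by norm_num) ?_
        exact ENNReal.toReal_mono (by simpa using hq.essInf_pos.ne') (ENNReal.inv_le_inv.2 hx)

end Modular

lemma div_mem_vectorGradients {X : Type*} [MetricSpace X] [MeasurableSpace X] {μ : Measure X}
    {s u : X → ℝ} {g : ℤ → X → ℝ≥0∞} (hg : g ∈ vectorGradients μ s u) {l : ℝ≥0} (hl : 0 < l) :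
    (fun k x => g k x / l) ∈ vectorGradients μ s (fun x => u x / l) := by
  obtain ⟨hgm, N, hN, h⟩ := hg
  refine ⟨fun k => (hgm k).div_const _, N, hN, fun k x y hx hy h1 h2 => ?_⟩
  have h3 := ENNReal.div_le_div_right (h k x y hx hy h1 h2) (l : ℝ≥0∞)
  have hl' : (0 : ℝ) < l := hl
  rw [← sub_div, abs_div, abs_of_pos hl', ENNReal.ofReal_div_of_pos hl', ENNReal.ofReal_coe_nnreal]
  refine h3.trans_eq ?_
  simp only [div_eq_mul_inv]
  ring

/-! ### Embeddings -/

section Embedding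

variable {X : Type*} [MetricSpace X] [MeasurableSpace X] [BorelSpace X]
  {μ : Measure X} {Q p s β : X → ℝ}

/-- Homogeneous form of the modular estimate. -/
theorem exists_luxNorm_le (hreg : LowerAhlforsRegular μ Q)
    (hp : IsLogExponent μ p) (hs : IsLogExponent μ s) (hspQ : ∀ x, s x * p x = Q x)
    (hpβ : ∀ᵐ x ∂μ, p x ≤ β x) {β₂ : ℝ} (hβ₂ : ∀ᵐ x ∂μ, β x ≤ β₂) :
    ∃ C : ℝ≥0, 0 < C ∧ ∀ u : X → ℝ, Measurable u → ∀ g ∈ vectorGradients μ s u, ∀ l : ℝ≥0, 0 < l →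
      modular μ p (fun x => ‖u x‖ₑ / l) ≤ 1 → (∀ k, modular μ p (fun x => g k x / l) ≤ 1) →
      u ∈ lpSpace μ β ∧ luxNorm μ β (fun x => ‖u x‖ₑ) ≤ C * l := by
  obtain ⟨p₁, hp₁0, hp₁⟩ := hp.bdd_below
  obtain ⟨K, hK1, hK⟩ := exists_modular_le hreg hp hs hspQ hpβ hβ₂
  have hβ₁ : ∀ᵐ x ∂μ, p₁ ≤ β x := by
    filter_upwards [hp₁, hpβ] with x h1 h2 using h1.trans h2
  have hC : 0 < K ^ (1 / p₁) := NNReal.rpow_pos (zero_lt_one.trans_le hK1)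
  refine ⟨K ^ (1 / p₁), hC, fun u hu g hg l hl hul hgl => ?_⟩
  have hul' : ∀ x, ‖u x / l‖ₑ = ‖u x‖ₑ / l := fun x => by
    have hl' : (0 : ℝ) < l := hl
    rw [Real.enorm_eq_ofReal_abs, abs_div, abs_of_pos hl', ENNReal.ofReal_div_of_pos hl',
      ENNReal.ofReal_coe_nnreal, Real.enorm_eq_ofReal_abs]
  have h1 := hK (fun x => u x / l) (hu.div_const _) _ (div_mem_vectorGradients hg hl)
    (by simpa only [hul'] using hul) hgl
  simp only [hul'] at h1
  refine ⟨⟨hu, modular_lt_top_of_div (hβ₁.mono fun x hx => hp₁0.le.trans hx) hβ₂ hl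
    (h1.trans_lt ENNReal.coe_lt_top)⟩, ?_⟩
  have h2 := modular_div_le_one hp₁0 hβ₁ hK1 h1
  simp only [← coe_mul_div_eq _ hC] at h2
  rw [← ENNReal.coe_mul]
  exact iInf₂_le (K ^ (1 / p₁) * l) ⟨mul_pos hC hl, h2⟩

/-- Embedding criterion for spaces defined by any gradient functional that dominates the modulars
of the components. -/
theorem embedsInLp_of_gradient (hreg : LowerAhlforsRegular μ Q)
    (hp : IsLogExponent μ p) (hs : IsLogExponent μ s) (hspQ : ∀ x, s x * p x = Q x)
    (hpβ : ∀ᵐ x ∂μ, p x ≤ β x) {β₂ : ℝ} (hβ₂ : ∀ᵐ x ∂μ, β x ≤ β₂)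
    (F : (ℤ → X → ℝ≥0∞) → ℝ≥0∞) {c : ℝ≥0} (hc : 1 ≤ c)
    (hF : ∀ (g : ℤ → X → ℝ≥0∞) (l : ℝ≥0), F g < l →
      ∀ k, modular μ p (fun x => g k x / ((c * l : ℝ≥0) : ℝ≥0∞)) ≤ 1) :
    EmbedsInLp μ {u | u ∈ lpSpace μ p ∧ ⨅ g ∈ vectorGradients μ s u, F g < ∞}
      (fun u => luxNorm μ p (fun x => ‖u x‖ₑ) + ⨅ g ∈ vectorGradients μ s u, F g) β := by
  have hp0 : ∀ᵐ x ∂μ, 0 ≤ p x := .of_forall fun x => (hp.pos x).le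
  obtain ⟨p₁, hp₁0, hp₁⟩ := hp.bdd_below
  obtain ⟨C, hC, h⟩ := exists_luxNorm_le hreg hp hs hspQ hpβ hβ₂
  have hCc : 0 < C * c := mul_pos hC (zero_lt_one.trans_le hc)
  refine ⟨C * c, fun u ⟨⟨hu, hup⟩, hug⟩ => ?_⟩
  have key : ∀ l : ℝ≥0, luxNorm μ p (fun x => ‖u x‖ₑ) +
      ⨅ g ∈ vectorGradients μ s u, F g < l →
      u ∈ lpSpace μ β ∧ luxNorm μ β (fun x => ‖u x‖ₑ) ≤ ((C * c : ℝ≥0) : ℝ≥0∞) * l := by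
    intro l hl
    have hl0 : 0 < l := by
      have := zero_le.trans_lt hl
      exact_mod_cast this
    have h1 := modular_div_le_one_of_luxNorm_lt hp0 (le_self_add.trans_lt hl)
    have h2 := le_add_self.trans_lt hl
    simp only [iInf_lt_iff] at h2
    obtain ⟨g, hg, hgl⟩ := h2
    have h3 := h u hu g hg (c * l) (mul_pos (zero_lt_one.trans_le hc) hl0)
      ((modular_mono hp0 (.of_forall fun x => ENNReal.div_le_div_left
        (by exact_mod_cast le_mul_of_one_le_left zero_le hc) _)).trans h1) (hF g l hgl)
    refine ⟨h3.1, h3.2.trans_eq ?_⟩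
    push_cast
    ring
  constructor
  -- Membership in `lpSpace` gives a finite modular only; a finite norm is needed for some real `l`
  -- above the total quasi-norm to exist.
  · have hfin : luxNorm μ p (fun x => ‖u x‖ₑ) < ∞ := by
      set M : ℝ≥0 := max 1 (modular μ p (fun x => ‖u x‖ₑ)).toNNReal
      have hM : modular μ p (fun x => ‖u x‖ₑ) ≤ M := by
        rw [← ENNReal.coe_toNNReal hup.ne]
        exact_mod_cast le_max_right _ _
      have hM1 : 1 ≤ M := le_max_left _ _
      exact (iInf₂_le (M ^ (1 / p₁)) ⟨NNReal.rpow_pos (zero_lt_one.trans_le hM1),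
        modular_div_le_one hp₁0 hp₁ hM1 hM⟩).trans_lt ENNReal.coe_lt_top
    obtain ⟨l, hl, _⟩ := ENNReal.lt_iff_exists_nnreal_btwn.1 (ENNReal.add_lt_top.2 ⟨hfin, hug⟩)
    exact (key l hl).1
  -- The estimate holds for each `l` strictly above the quasi-norm; letting `l` decrease to it also
  -- covers quasi-norm zero.
  · rw [← ENNReal.div_le_iff' (by exact_mod_cast hCc.ne') ENNReal.coe_ne_top]
    refine le_of_forall_gt_imp_ge_of_dense fun a ha => ?_
    obtain ⟨l, hl, hla⟩ := ENNReal.lt_iff_exists_nnreal_btwn.1 ha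
    refine le_trans ?_ hla.le
    rw [ENNReal.div_le_iff' (by exact_mod_cast hCc.ne') ENNReal.coe_ne_top]
    exact (key l hl).2

theorem tlSpace_embedsInLp (hreg : LowerAhlforsRegular μ Q)
    (hp : IsLogExponent μ p) (hs : IsLogExponent μ s) (hspQ : ∀ x, s x * p x = Q x)
    (hpβ : ∀ᵐ x ∂μ, p x ≤ β x) {β₂ : ℝ} (hβ₂ : ∀ᵐ x ∂μ, β x ≤ β₂) {q : X → ℝ≥0∞}
    (hq : IsExponent μ q) : EmbedsInLp μ (tlSpace μ s p q) (tlNorm μ s p q) β :=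
  embedsInLp_of_gradient hreg hp hs hspQ hpβ hβ₂ (lpSeqNorm μ p q) le_rfl fun g l hgl k => by
    rw [one_mul]
    exact modular_div_le_one_of_lpSeqNorm_lt (.of_forall fun x => (hp.pos x).le) hq hgl k

theorem besovSpace_embedsInLp (hreg : LowerAhlforsRegular μ Q)
    (hp : IsLogExponent μ p) (hs : IsLogExponent μ s) (hspQ : ∀ x, s x * p x = Q x)
    (hpβ : ∀ᵐ x ∂μ, p x ≤ β x) {β₂ : ℝ} (hβ₂ : ∀ᵐ x ∂μ, β x ≤ β₂) {q : X → ℝ≥0∞}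
    (hq : IsExponent μ q) : EmbedsInLp μ (besovSpace μ s p q) (besovNorm μ s p q) β :=
  embedsInLp_of_gradient hreg hp hs hspQ hpβ hβ₂ (seqLpNorm μ p q)
    (NNReal.one_le_rpow one_le_two ENNReal.toReal_nonneg) fun _ _ hgl k =>
      modular_div_le_one_of_seqLpNorm_lt (.of_forall fun x => (hp.pos x).le) hq hgl k

end Embedding

end VarHajlasz

/-! ### The three critical embeddings -/

theorem mainTheorem7 {X : Type*} [MetricSpace X] [MeasurableSpace X] [BorelSpace X]
    (μ : Measure X) (hμ : VarHajlasz.IsMetricMeasure μ)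
    (hX : VarHajlasz.GeometricallyDoubling X)
    (hball : ∃ δ C : ℝ, 0 < δ ∧ ∀ x : X, μ (Metric.ball x δ) ≤ ENNReal.ofReal C)
    (Q p s : X → ℝ)
    (hQ : VarHajlasz.IsLogExponent μ Q) (hreg : VarHajlasz.LowerAhlforsRegular μ Q)
    (hp : VarHajlasz.IsLogExponent μ p) (hs : VarHajlasz.IsLogExponent μ s)
    (hspQ : ∀ x, s x * p x = Q x) :
    (∀ q : X → ℝ≥0∞, VarHajlasz.IsExponent μ q →
      ∀ β : X → ℝ, VarHajlasz.IsBddExponent μ β → VarHajlasz.StronglyLess μ p β →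
        VarHajlasz.EmbedsInLp μ (VarHajlasz.tlSpace μ s p q) (VarHajlasz.tlNorm μ s p q) β) ∧
    (∀ q : X → ℝ≥0∞, VarHajlasz.IsExponent μ q → (∀ x, q x ≤ ENNReal.ofReal (p x)) →
      ∀ β : X → ℝ, VarHajlasz.IsBddExponent μ β → VarHajlasz.StronglyLess μ p β →
        VarHajlasz.EmbedsInLp μ (VarHajlasz.besovSpace μ s p q)
          (VarHajlasz.besovNorm μ s p q) β) ∧
    (∀ q : X → ℝ≥0∞, VarHajlasz.IsExponent μ q →
      ∀ t : X → ℝ, VarHajlasz.IsLogExponent μ t → VarHajlasz.StronglyLess μ t s →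
        VarHajlasz.EmbedsInLp μ (VarHajlasz.besovSpace μ s p q) (VarHajlasz.besovNorm μ s p q)
          (fun x => Q x * p x / (Q x - t x * p x))) := by
  have hle : ∀ β : X → ℝ, VarHajlasz.StronglyLess μ p β → ∀ᵐ x ∂μ, p x ≤ β x := by
    rintro β ⟨c, hc, h⟩
    filter_upwards [h] with x hx
    linarith
  refine ⟨fun q hq β hβ hpβ => ?_, fun q hq _ β hβ hpβ => ?_, fun q hq t ht hts => ?_⟩
  · obtain ⟨β₂, hβ₂⟩ := hβ.bdd_above
    exact VarHajlasz.tlSpace_embedsInLp hreg hp hs hspQ (hle β hpβ) hβ₂ hq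
  · obtain ⟨β₂, hβ₂⟩ := hβ.bdd_above
    exact VarHajlasz.besovSpace_embedsInLp hreg hp hs hspQ (hle β hpβ) hβ₂ hq
  · obtain ⟨c, hc, hts⟩ := hts
    obtain ⟨p₂, hp₂⟩ := hp.bdd_above
    obtain ⟨s₂, hs₂⟩ := hs.bdd_above
    -- Cancelling `p` through `Q = s p` gives `σ = s p / (s - t)`, so `t ≪ s` bounds `σ` above, and
    -- `t > 0` gives `σ ≥ p`.
    have hσ : ∀ x, 0 < s x - t x → Q x * p x / (Q x - t x * p x) = s x * p x / (s x - t x) := by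
      intro x hx
      have hpx := hp.pos x
      rw [← hspQ x, ← sub_mul]
      field_simp
    refine VarHajlasz.besovSpace_embedsInLp (β₂ := s₂ * p₂ / c) hreg hp hs hspQ ?_ ?_ hq
    · filter_upwards [hts] with x hx
      have hd : 0 < s x - t x := by linarith
      rw [hσ x hd, le_div_iff₀ hd]
      nlinarith [hp.pos x, ht.pos x]
    · filter_upwards [hts, hp₂, hs₂] with x hx h1 h2
      have hd : 0 < s x - t x := by linarith
      have hpx := hp.pos x
      have hsx := hs.pos x
      rw [hσ x hd]
      have hs₂0 : 0 ≤ s₂ := hsx.le.trans h2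
      have hp₂0 : 0 ≤ p₂ := hpx.le.trans h1
      gcongr
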